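/- Lemma 2.2 (Poincaré inequality in Lorentz spaces). For a measurable set $\Omega\subset\mathbb R^n$ and a measurable (scalar- or vector-valued) function $f$ on $\Omega$, let $f_*(\alpha)=|\{x\in\Omega:|f(x)|>\alpha\}|$, $f^*(t)=\inf\{\alpha>0: f_*(\alpha)\le t\}$ (with $\inf\emptyset=\infty$), and, for $1\le p<\infty$, $$\|f\|_{L^{p,q}(\Omega)}=\Big(\int_0^\infty \big(t^{1/p}f^*(t)\big)^q\,\frac{dt}{t}\Big)^{1/q}\ (1\le q<\infty),\qquad \|f\|_{L^{p,\infty}(\Omega)}=\sup_{t>0}t^{1/p}f^*(t).$$ Let $n>2$ be an integer, $1<p<\infty$ and $1\le q\le\infty$. There is a constant $C>0$, depending only on $n,p,q$, with the following property. Let $B(\varrho)\subset\mathbb R^n$ be any open ball of radius $\varrho>0$ (with any centre), and let $f:B(\varrho)\to\mathbb R$ be a locally integrable function whose weak gradient $\nabla f$ is locally integrable and satisfies $\|\nabla f\|_{L^{p,q}(B(\varrho))}<\infty$. Then $f$ is integrable on $B(\varrho)$, and with $\overline f=\frac{1}{|B(\varrho)|}\int_{B(\varrho)}f\,dx$, $$\|f-\overline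 f\|_{L^{p,q}(B(\varrho))}\le C\varrho\,\|\nabla f\|_{L^{p,q}(B(\varrho))}.$$ -/

import Mathlib

open MeasureTheory
open scoped ENNReal

/-- The distribution function `f_*(α) = |{x ∈ Ω : |f(x)| > α}|`. -/
noncomputable def distributionFunction {α F : Type*} [MeasureSpace α] [NormedAddCommGroup F]
    (Ω : Set α) (f : α → F) (a : ℝ≥0∞) : ℝ≥0∞ :=
  volume {x | x ∈ Ω ∧ a < ‖f x‖ₑ}

/-- The decreasing rearrangement `f^*(t) = inf {a > 0 : f_*(a) ≤ t}`, with `inf ∅ = ∞`. -/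
noncomputable def decreasingRearrangement {α F : Type*} [MeasureSpace α] [NormedAddCommGroup F]
    (Ω : Set α) (f : α → F) (t : ℝ) : ℝ≥0∞ :=
  sInf {a : ℝ≥0∞ | 0 < a ∧ distributionFunction Ω f a ≤ ENNReal.ofReal t}

/-- The Lorentz (quasi-)norm of `L^{p,q}(Ω)`, with values in `[0, ∞]`:
`(∫₀^∞ (t^{1/p} f^*(t))^q dt/t)^{1/q}` if `q < ∞`, and `sup_{t > 0} t^{1/p} f^*(t)` if `q = ∞`.
For `p = ∞` the exponent `1/p` is `0`. -/
noncomputable def lorentzNorm {α F : Type*} [MeasureSpace α] [NormedAddCommGroup F]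
    (p q : ℝ≥0∞) (Ω : Set α) (f : α → F) : ℝ≥0∞ :=
  if q = ⊤ then
    ⨆ t ∈ Set.Ioi (0 : ℝ),
      ENNReal.ofReal t ^ (p⁻¹).toReal * decreasingRearrangement Ω f t
  else
    (∫⁻ t in Set.Ioi (0 : ℝ),
      (ENNReal.ofReal t ^ (p⁻¹).toReal * decreasingRearrangement Ω f t) ^ q.toReal
        / ENNReal.ofReal t) ^ (q⁻¹).toReal

/-- `g` is a weak gradient of `f ∈ L¹_loc(Ω)` on the open set `Ω ⊆ ℝⁿ`: `g ∈ L¹_loc(Ω; ℝⁿ)` and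
`∫_Ω f ∂ᵢφ = - ∫_Ω gᵢ φ` for every `φ ∈ C_c^∞(Ω)` and every `i`. -/
structure IsWeakGradient {n : ℕ} (Ω : Set (EuclideanSpace ℝ (Fin n)))
    (f : EuclideanSpace ℝ (Fin n) → ℝ)
    (g : EuclideanSpace ℝ (Fin n) → EuclideanSpace ℝ (Fin n)) : Prop where
  locallyIntegrableOn : LocallyIntegrableOn f Ω
  locallyIntegrableOn_grad : LocallyIntegrableOn g Ω
  integral_eq : ∀ φ : EuclideanSpace ℝ (Fin n) → ℝ, ContDiff ℝ (⊤ : ℕ∞) φ → HasCompactSupport φ →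
    tsupport φ ⊆ Ω → ∀ i : Fin n,
      ∫ x in Ω, f x * fderiv ℝ φ x (EuclideanSpace.single i 1) = - ∫ x in Ω, g x i * φ x

/-!
The proof uses neither a singular kernel nor mollification. Testing the definition of the weak
gradient `g` with the translates `ψ (· - s v)` and integrating over `s ∈ (0, 1)` shows that, for
every vector `v`, `f (x + v) - f x = ∫₀¹ ⟨g (x + s v), v⟩ ds` for almost every `x`
with `x` and `x + v` in the ball (`ae_sub_eq_integral_inner`). By Fubini's theorem, `|f x - f y|` is at most
`|x - y| ∫₀¹ |g ((1 - s) x + s y)| ds` for almost all `x, y` in the ball `B` of radius `ρ`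
(`ae_ae_enorm_sub_le`). Averaging in `y` gives `|f - mean f| ≤ (2ρ / |B|) T |g|` almost everywhere,
where `T u x = ∫_B ∫₀¹ u ((1 - s) x + s y) ds dy` (`segmentIntegral`).

The operator `T` is bounded with norm at most `2ⁿ |B|` both on `L^∞(B)`, which is immediate, and on
`L¹(B)` (`setLIntegral_segmentIntegral_le`): for `s ≤ 1/2` change variables in `x`, for `s ≥ 1/2` in
`y`. Cutting `|g|` at the level `g^*(t)` and applying the first bound below that level and the
second above it shows that `(f - mean f)^*(t)` is at most `2ⁿ⁺¹ ρ` times the mean of `g^*` over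
`(0, t)` (`decreasingRearrangement_le_mean`). Hardy's inequality (`lintegral_mean_rpow_le`,
`rpow_mul_mean_le`) bounds the `L^{p,q}` norm of these means by `p / (p - 1)` times that of `g`. It
also shows that they are finite, whence `g ∈ L¹(B)` (`setLIntegral_enorm_lt_top_of_lorentzNorm`),
and then `f ∈ L¹(B)` because `T |g|` is finite almost everywhere.
-/

/-! ### Distribution functions and rearrangements -/

/-- The layer cake formula for functions with values in `[0, ∞]`. -/
theorem lintegral_eq_lintegral_measure_ofReal_lt {α : Type*} [MeasurableSpace α] (μ : Measure α)
    [SFinite μ] {u : α → ℝ≥0∞} (hu : Measurable u) :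
    ∫⁻ x, u x ∂μ = ∫⁻ a in Set.Ioi (0 : ℝ), μ {x | ENNReal.ofReal a < u x} := by
  have hset : MeasurableSet {z : α × ℝ | ENNReal.ofReal z.2 < u z.1} :=
    measurableSet_lt (ENNReal.measurable_ofReal.comp measurable_snd) (hu.comp measurable_fst)
  have h1 : ∀ x, u x = ∫⁻ a in Set.Ioi (0 : ℝ),
      {z : α × ℝ | ENNReal.ofReal z.2 < u z.1}.indicator 1 (x, a) := by
    intro x
    have h2 : (fun a : ℝ => {z : α × ℝ | ENNReal.ofReal z.2 < u z.1}.indicator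
        (1 : α × ℝ → ℝ≥0∞) (x, a)) = {a : ℝ | ENNReal.ofReal a < u x}.indicator 1 := by
      ext a; simp [Set.indicator]
    have h3 : MeasurableSet {a : ℝ | ENNReal.ofReal a < u x} :=
      measurableSet_lt ENNReal.measurable_ofReal measurable_const
    rw [h2, lintegral_indicator_one h3, Measure.restrict_apply h3]
    by_cases hx : u x = ⊤
    · have : {a : ℝ | ENNReal.ofReal a < u x} ∩ Set.Ioi 0 = Set.Ioi 0 := by
        ext a; simp [hx]
      rw [this, Real.volume_Ioi, hx]
    · have : {a : ℝ | ENNReal.ofReal a < u x} ∩ Set.Ioi 0 = Set.Ioo 0 (u x).toReal := by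
        ext a
        simp only [Set.mem_inter_iff, Set.mem_ofPred_eq, Set.mem_Ioi, Set.mem_Ioo]
        constructor
        · rintro ⟨h, h0⟩
          exact ⟨h0, (ENNReal.ofReal_lt_iff_lt_toReal h0.le hx).1 h⟩
        · rintro ⟨h0, h⟩
          exact ⟨(ENNReal.ofReal_lt_iff_lt_toReal h0.le hx).2 h, h0⟩
      rw [this, Real.volume_Ioo, sub_zero, ENNReal.ofReal_toReal hx]
  calc ∫⁻ x, u x ∂μ = ∫⁻ x, (∫⁻ a in Set.Ioi (0 : ℝ),
        {z : α × ℝ | ENNReal.ofReal z.2 < u z.1}.indicator 1 (x, a)) ∂μ :=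
        lintegral_congr h1
    _ = ∫⁻ a in Set.Ioi (0 : ℝ), (∫⁻ x,
        {z : α × ℝ | ENNReal.ofReal z.2 < u z.1}.indicator 1 (x, a) ∂μ) := by
        apply lintegral_lintegral_swap
        exact (measurable_one.indicator hset).aemeasurable
    _ = _ := by
        refine lintegral_congr fun a => ?_
        have h2 : (fun x : α => {z : α × ℝ | ENNReal.ofReal z.2 < u z.1}.indicator
            (1 : α × ℝ → ℝ≥0∞) (x, a)) = {x : α | ENNReal.ofReal a < u x}.indicator 1 := by
          ext x; simp [Set.indicator]
        rw [h2, lintegral_indicator_one (measurableSet_lt measurable_const hu)]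

theorem lintegral_le_lintegral_of_measure_lt_le {α β : Type*} [MeasurableSpace α]
    [MeasurableSpace β] {μ : Measure α} {ν : Measure β} [SFinite μ] [SFinite ν]
    {u : α → ℝ≥0∞} {w : β → ℝ≥0∞} (hu : Measurable u) (hw : Measurable w)
    (h : ∀ a : ℝ≥0∞, μ {x | a < u x} ≤ ν {x | a < w x}) :
    ∫⁻ x, u x ∂μ ≤ ∫⁻ x, w x ∂ν := by
  rw [lintegral_eq_lintegral_measure_ofReal_lt μ hu, lintegral_eq_lintegral_measure_ofReal_lt ν hw]
  exact lintegral_mono fun a => h _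

section Rearrangement

variable {α F : Type*} [MeasureSpace α] [NormedAddCommGroup F] {Ω : Set α} {f : α → F}

theorem decreasingRearrangement_antitone : Antitone (decreasingRearrangement Ω f) := by
  intro s t hst
  exact sInf_le_sInf fun a ha => ⟨ha.1, ha.2.trans (ENNReal.ofReal_le_ofReal hst)⟩

theorem measurable_decreasingRearrangement : Measurable (decreasingRearrangement Ω f) :=
  decreasingRearrangement_antitone.measurable

theorem distributionFunction_antitone : Antitone (distributionFunction Ω f) := by
  intro a b hab
  exact measure_mono fun x hx => ⟨hx.1, hab.trans_lt hx.2⟩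

/-- Right continuity of the distribution function, expressed through the rearrangement. -/
theorem lt_decreasingRearrangement {a : ℝ≥0∞} {s : ℝ}
    (h : ENNReal.ofReal s < distributionFunction Ω f a) : a < decreasingRearrangement Ω f s := by
  have ha : a < ⊤ := by
    by_contra ha
    have : a = ⊤ := by simpa using ha
    simp [distributionFunction, this] at h
  obtain ⟨u, hu, hu', hlim⟩ := exists_seq_strictAnti_tendsto' ha
  have hU : {x | x ∈ Ω ∧ a < ‖f x‖ₑ} = ⋃ n, {x | x ∈ Ω ∧ u n < ‖f x‖ₑ} := by
    ext x
    simp only [Set.mem_ofPred_eq, Set.mem_iUnion]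
    constructor
    · rintro ⟨hx, hax⟩
      obtain ⟨n, hn⟩ := (hlim.eventually (gt_mem_nhds hax)).exists
      exact ⟨n, hx, hn⟩
    · rintro ⟨n, hx, hn⟩
      exact ⟨hx, (hu' n).1.trans hn⟩
  have hmono : Monotone fun n => {x | x ∈ Ω ∧ u n < ‖f x‖ₑ} := by
    intro m n hmn x hx
    exact ⟨hx.1, (hu.antitone hmn).trans_lt hx.2⟩
  have h2 := h
  rw [distributionFunction, hU, hmono.measure_iUnion, lt_iSup_iff] at h2
  obtain ⟨n, hn⟩ := h2
  refine (hu' n).1.trans_le (le_sInf ?_)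
  rintro b ⟨-, hb⟩
  by_contra hlt
  exact absurd hn (not_lt.2 ((distributionFunction_antitone (not_le.1 hlt).le).trans hb))

theorem distributionFunction_decreasingRearrangement_le (t : ℝ) :
    distributionFunction Ω f (decreasingRearrangement Ω f t) ≤ ENNReal.ofReal t := by
  by_contra h
  exact lt_irrefl _ (lt_decreasingRearrangement (not_le.1 h))

theorem decreasingRearrangement_le_of_forall_lt {b : ℝ≥0∞} {t : ℝ}
    (h : ∀ a, b < a → a < ⊤ → distributionFunction Ω f a ≤ ENNReal.ofReal t) :
    decreasingRearrangement Ω f t ≤ b := by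
  refine le_of_forall_gt_imp_ge_of_dense fun a hab => ?_
  rcases eq_or_ne a ⊤ with rfl | ha
  · exact le_top
  · exact sInf_le ⟨pos_of_gt hab, h a hab (lt_top_iff_ne_top.2 ha)⟩

theorem decreasingRearrangement_eq_zero {t : ℝ} (h : volume Ω ≤ ENNReal.ofReal t) :
    decreasingRearrangement Ω f t = 0 := by
  refine le_antisymm (decreasingRearrangement_le_of_forall_lt fun a _ _ => ?_) zero_le
  exact (measure_mono fun x hx => hx.1).trans h

/-- One half of the equimeasurability of `f` and `f^*`, with `f^*` restricted to an interval that
is long enough for the level `a`. -/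
theorem distributionFunction_le_volume_lt_decreasingRearrangement (a : ℝ≥0∞) (T : ℝ)
    (h : distributionFunction Ω f a ≤ ENNReal.ofReal T) :
    distributionFunction Ω f a ≤
      volume.restrict (Set.Ioo 0 T) {s | a < decreasingRearrangement Ω f s} := by
  have hne : distributionFunction Ω f a ≠ ⊤ := (h.trans_lt ENNReal.ofReal_lt_top).ne
  rw [Measure.restrict_apply (measurableSet_lt measurable_const measurable_decreasingRearrangement)]
  calc distributionFunction Ω f a = volume (Set.Ioo 0 (distributionFunction Ω f a).toReal) := by
        rw [Real.volume_Ioo, sub_zero, ENNReal.ofReal_toReal hne]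
    _ ≤ _ := by
        refine measure_mono ?_
        rintro s ⟨hs0, hs⟩
        have hs' := (ENNReal.ofReal_lt_iff_lt_toReal hs0.le hne).2 hs
        refine ⟨lt_decreasingRearrangement hs', hs0, ?_⟩
        exact (ENNReal.ofReal_lt_ofReal_iff_of_nonneg hs0.le).1 (hs'.trans_le h)

/-- The part of `|f|` above the level `f^*(t)` has at most the integral of the part of `f^*` above
that level, which lives on `(0, t)`. -/
theorem setLIntegral_enorm_sub_le [SFinite (volume : Measure α)]
    [MeasurableSpace F] [OpensMeasurableSpace F]
    (hf : Measurable f) (t : ℝ) :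
    ∫⁻ x in Ω, (‖f x‖ₑ - decreasingRearrangement Ω f t) ≤
      ∫⁻ s in Set.Ioo 0 t, (decreasingRearrangement Ω f s - decreasingRearrangement Ω f t) := by
  refine lintegral_le_lintegral_of_measure_lt_le (hf.enorm.sub measurable_const)
    (measurable_decreasingRearrangement.sub measurable_const) fun a => ?_
  set c := decreasingRearrangement Ω f t
  have h1 : volume.restrict Ω {x | a < ‖f x‖ₑ - c} = distributionFunction Ω f (a + c) := by
    rw [Measure.restrict_apply
      (measurableSet_lt measurable_const (hf.enorm.sub_const _)), distributionFunction]
    congr 1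
    ext x
    simp [lt_tsub_iff_right, and_comm]
  rw [h1]
  have h2 : distributionFunction Ω f (a + c) ≤ ENNReal.ofReal t :=
    (distributionFunction_antitone le_add_self).trans
      (distributionFunction_decreasingRearrangement_le t)
  simpa [lt_tsub_iff_right] using
    distributionFunction_le_volume_lt_decreasingRearrangement (a + c) t h2

theorem setLIntegral_enorm_le [SFinite (volume : Measure α)]
    [MeasurableSpace F] [OpensMeasurableSpace F]
    (hf : Measurable f) {T : ℝ} (hT : volume Ω ≤ ENNReal.ofReal T) :
    ∫⁻ x in Ω, ‖f x‖ₑ ≤ ∫⁻ s in Set.Ioo 0 T, decreasingRearrangement Ω f s := by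
  simpa [decreasingRearrangement_eq_zero (f := f) hT] using setLIntegral_enorm_sub_le (Ω := Ω) hf T

/-- Calderón's estimate: if `|h|` is controlled by `M c` plus an error whose integral is at most
`M` times that of `(|f| - c)₊`, at every level `c`, then `h^*(t)` is at most `M` times the mean of
`f^*` over `(0, t)`. -/
theorem decreasingRearrangement_le_mean [SFinite (volume : Measure α)]
    [MeasurableSpace F] [OpensMeasurableSpace F]
    (hf : Measurable f) {F' : Type*} [NormedAddCommGroup F'] {h : α → F'}
    {M : ℝ≥0∞} (w : ℝ≥0∞ → α → ℝ≥0∞) (hw : ∀ c, Measurable (w c))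
    (hle : ∀ c, ∀ᵐ x, x ∈ Ω → ‖h x‖ₑ ≤ M * c + w c x)
    (hint : ∀ c, ∫⁻ x in Ω, w c x ≤ M * ∫⁻ x in Ω, (‖f x‖ₑ - c)) {t : ℝ} (ht : 0 < t) :
    decreasingRearrangement Ω h t ≤
      M * ((∫⁻ s in Set.Ioo 0 t, decreasingRearrangement Ω f s) / ENNReal.ofReal t) := by
  set c := decreasingRearrangement Ω f t
  set τ := ENNReal.ofReal t
  have hτ : τ ≠ 0 := by simpa [τ] using ht
  have hτ' : τ ≠ ⊤ := ENNReal.ofReal_ne_top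
  set I := ∫⁻ s in Set.Ioo 0 t, (decreasingRearrangement Ω f s - c) with hI
  have hsum : ∫⁻ s in Set.Ioo 0 t, decreasingRearrangement Ω f s = I + c * τ := by
    have : ∫⁻ s in Set.Ioo 0 t, c = c * τ := by simp [τ]
    rw [← this, hI, ← lintegral_add_right _ measurable_const]
    refine setLIntegral_congr_fun measurableSet_Ioo fun s hs => ?_
    exact (tsub_add_cancel_of_le (decreasingRearrangement_antitone hs.2.le)).symm
  have hdiv : (I + c * τ) / τ = I / τ + c := by
    rw [ENNReal.add_div, ENNReal.mul_div_cancel_right hτ hτ']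
  rw [hsum, hdiv]
  refine decreasingRearrangement_le_of_forall_lt fun a hab ha => ?_
  have hlt : M * c + M * I / τ < a := by
    refine lt_of_eq_of_lt ?_ hab
    rw [mul_add, add_comm, mul_div_assoc]
  have hlt' : M * I / τ < a - M * c := by
    rw [add_comm] at hlt; exact lt_tsub_iff_right.2 hlt
  -- Markov's inequality for `w c` at the height `d`.
  set d := a - M * c
  have hd : d ≠ 0 := (pos_of_gt hlt').ne'
  have hd' : d ≠ ⊤ := (tsub_le_self.trans_lt ha).ne
  have hsub : distributionFunction Ω h a ≤ volume.restrict Ω {x | d ≤ w c x} := by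
    rw [Measure.restrict_apply (measurableSet_le measurable_const (hw c))]
    refine measure_mono_ae ?_
    filter_upwards [hle c] with x hx
    rintro ⟨hxΩ, hax⟩
    refine ⟨?_, hxΩ⟩
    exact tsub_le_iff_left.2 (hax.le.trans (hx hxΩ))
  refine hsub.trans ?_
  have hmk := mul_meas_ge_le_lintegral (μ := volume.restrict Ω) (hw c) d
  have h3 : d * volume.restrict Ω {x | d ≤ w c x} ≤ d * τ := by
    refine hmk.trans ((hint c).trans ?_)
    calc M * ∫⁻ x in Ω, (‖f x‖ₑ - c) ≤ M * I := by
          gcongr; exact setLIntegral_enorm_sub_le hf t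
      _ ≤ d * τ := (ENNReal.div_le_iff hτ hτ').1 hlt'.le
  exact (ENNReal.mul_le_mul_iff_right hd hd').1 h3

end Rearrangement

/-! ### Hardy's inequality -/

/-- Jensen's inequality for `x ^ Q`, with respect to a measure that is not normalized. -/
theorem lintegral_rpow_le_mul_measure_univ {α : Type*} [MeasurableSpace α] (μ : Measure α)
    {Q : ℝ} (hQ : 1 ≤ Q) {u : α → ℝ≥0∞} (hu : Measurable u) :
    (∫⁻ x, u x ∂μ) ^ Q ≤ (∫⁻ x, u x ^ Q ∂μ) * μ Set.univ ^ (Q - 1) := by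
  have hQ0 : 0 < Q := by linarith
  have h := eLpNorm'_le_eLpNorm'_mul_rpow_measure_univ (μ := μ) (f := u) one_pos hQ
    hu.aestronglyMeasurable
  simp only [eLpNorm', enorm_eq_self, ENNReal.rpow_one, div_one, one_div] at h
  calc (∫⁻ x, u x ∂μ) ^ Q
      ≤ ((∫⁻ x, u x ^ Q ∂μ) ^ Q⁻¹ * μ Set.univ ^ (1 - Q⁻¹)) ^ Q := by
        have := ENNReal.rpow_le_rpow h hQ0.le
        simpa using this
    _ = _ := by
        rw [ENNReal.mul_rpow_of_nonneg _ _ hQ0.le, ← ENNReal.rpow_mul, ← ENNReal.rpow_mul,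
          inv_mul_cancel₀ hQ0.ne', ENNReal.rpow_one, sub_mul, inv_mul_cancel₀ hQ0.ne', one_mul]

theorem setLIntegral_Ioo_rpow_neg {γ t : ℝ} (hγ : γ < 1) (ht : 0 < t) :
    ∫⁻ s in Set.Ioo 0 t, ENNReal.ofReal s ^ (-γ) =
      ENNReal.ofReal (1 - γ)⁻¹ * ENNReal.ofReal t ^ (1 - γ) := by
  have hcongr : ∫⁻ s in Set.Ioo 0 t, ENNReal.ofReal s ^ (-γ) =
      ∫⁻ s in Set.Ioo 0 t, ENNReal.ofReal (s ^ (-γ)) :=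
    setLIntegral_congr_fun measurableSet_Ioo fun s hs => ENNReal.ofReal_rpow_of_pos hs.1
  have hint : IntegrableOn (fun s : ℝ => s ^ (-γ)) (Set.Ioo 0 t) :=
    ((intervalIntegrable_iff_integrableOn_Ioo_of_le ht.le).1
      (intervalIntegral.intervalIntegrable_rpow' (by linarith)))
  rw [hcongr, ← ofReal_integral_eq_lintegral_ofReal hint
    ((ae_restrict_iff' measurableSet_Ioo).2 (ae_of_all _ fun s hs => Real.rpow_nonneg hs.1.le _)),
    ← integral_Ioc_eq_integral_Ioo, ← intervalIntegral.integral_of_le ht.le,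
    integral_rpow (Or.inl (by linarith)), ENNReal.ofReal_rpow_of_pos ht, ← ENNReal.ofReal_mul
      (by rw [inv_nonneg]; linarith), Real.zero_rpow (by linarith)]
  congr 1
  rw [sub_zero, div_eq_inv_mul]
  ring_nf

theorem setLIntegral_Ioi_rpow {γ s : ℝ} (hγ : γ < 1) (hs : 0 < s) :
    ∫⁻ t in Set.Ioi s, ENNReal.ofReal t ^ (γ - 2) =
      ENNReal.ofReal (1 - γ)⁻¹ * ENNReal.ofReal s ^ (γ - 1) := by
  have hcongr : ∫⁻ t in Set.Ioi s, ENNReal.ofReal t ^ (γ - 2) =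
      ∫⁻ t in Set.Ioi s, ENNReal.ofReal (t ^ (γ - 2)) :=
    setLIntegral_congr_fun measurableSet_Ioi fun t ht => ENNReal.ofReal_rpow_of_pos (hs.trans ht)
  rw [hcongr, ← ofReal_integral_eq_lintegral_ofReal
    (integrableOn_Ioi_rpow_of_lt (by linarith) hs)
    ((ae_restrict_iff' measurableSet_Ioi).2
      (ae_of_all _ fun t ht => Real.rpow_nonneg (hs.trans ht).le _)),
    integral_Ioi_rpow_of_lt (by linarith) hs, ENNReal.ofReal_rpow_of_pos hs, ← ENNReal.ofReal_mul
      (by rw [inv_nonneg]; linarith)]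
  congr 1
  have h1 : γ - 2 + 1 = γ - 1 := by ring
  rw [h1, ← neg_sub 1 γ, neg_div_neg_eq, div_eq_inv_mul]

/-- Hölder's inequality with respect to the measure `s ^ (-γ) ds` on `(0, t)`. -/
theorem setLIntegral_rpow_le {γ Q t : ℝ} (hγ' : γ < 1) (hQ : 1 ≤ Q) (ht : 0 < t)
    {φ : ℝ → ℝ≥0∞} (hφ : Measurable φ) :
    (∫⁻ s in Set.Ioo 0 t, φ s) ^ Q ≤
      (∫⁻ s in Set.Ioo 0 t, φ s ^ Q * ENNReal.ofReal s ^ (γ * (Q - 1))) *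
        (ENNReal.ofReal (1 - γ)⁻¹ * ENNReal.ofReal t ^ (1 - γ)) ^ (Q - 1) := by
  have hQ0 : 0 ≤ Q := by linarith
  have hm : ∀ r : ℝ, Measurable fun s : ℝ => ENNReal.ofReal s ^ r := fun r =>
    ENNReal.measurable_ofReal.pow_const r
  set μ := (volume.restrict (Set.Ioo 0 t)).withDensity fun s => ENNReal.ofReal s ^ (-γ)
  have hpos : ∀ s ∈ Set.Ioo 0 t, ENNReal.ofReal s ≠ 0 := fun s hs => by simpa using hs.1
  have h := lintegral_rpow_le_mul_measure_univ μ hQ (hφ.mul (hm γ))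
  have h1 : ∫⁻ s, (φ * fun s => ENNReal.ofReal s ^ γ) s ∂μ = ∫⁻ s in Set.Ioo 0 t, φ s := by
    rw [lintegral_withDensity_eq_lintegral_mul _ (hm _) (hφ.mul (hm γ))]
    refine setLIntegral_congr_fun measurableSet_Ioo fun s hs => ?_
    simp only [Pi.mul_apply]
    rw [mul_left_comm, ← ENNReal.rpow_add _ _ (hpos s hs) ENNReal.ofReal_ne_top]
    simp
  have h2 : ∫⁻ s, (φ * fun s => ENNReal.ofReal s ^ γ) s ^ Q ∂μ =
      ∫⁻ s in Set.Ioo 0 t, φ s ^ Q * ENNReal.ofReal s ^ (γ * (Q - 1)) := by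
    rw [lintegral_withDensity_eq_lintegral_mul _ (hm _) ((hφ.mul (hm γ)).pow_const Q)]
    refine setLIntegral_congr_fun measurableSet_Ioo fun s hs => ?_
    simp only [Pi.mul_apply]
    rw [ENNReal.mul_rpow_of_nonneg _ _ hQ0, ← ENNReal.rpow_mul, mul_left_comm,
      ← ENNReal.rpow_add _ _ (hpos s hs) ENNReal.ofReal_ne_top]
    ring_nf
  have h3 : μ Set.univ = ENNReal.ofReal (1 - γ)⁻¹ * ENNReal.ofReal t ^ (1 - γ) := by
    rw [withDensity_apply _ MeasurableSet.univ, Measure.restrict_univ,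
      setLIntegral_Ioo_rpow_neg hγ' ht]
  rwa [h1, h2, h3] at h

/-- Hardy's inequality for the averages of `φ` over `(0, t)`, with the weights of `L^{p,q}`, where
`γ = 1 / p`. -/
theorem lintegral_mean_rpow_le {γ Q : ℝ} (hγ : γ < 1) (hQ : 1 ≤ Q)
    {φ : ℝ → ℝ≥0∞} (hφ : Measurable φ) :
    ∫⁻ t in Set.Ioi (0 : ℝ), (ENNReal.ofReal t ^ γ *
        ((∫⁻ s in Set.Ioo 0 t, φ s) / ENNReal.ofReal t)) ^ Q / ENNReal.ofReal t ≤
      ENNReal.ofReal (1 - γ)⁻¹ ^ Q *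
        ∫⁻ t in Set.Ioi (0 : ℝ), (ENNReal.ofReal t ^ γ * φ t) ^ Q / ENNReal.ofReal t := by
  have hQ0 : 0 ≤ Q := by linarith
  set K := ENNReal.ofReal (1 - γ)⁻¹ with hK
  have hm : ∀ r : ℝ, Measurable fun s : ℝ => ENNReal.ofReal s ^ r := fun r =>
    ENNReal.measurable_ofReal.pow_const r
  set ψ : ℝ → ℝ≥0∞ := fun s => φ s ^ Q * ENNReal.ofReal s ^ (γ * (Q - 1)) with hψ
  have hψm : Measurable ψ := (hφ.pow_const Q).mul (hm _)
  have hpt : ∀ t ∈ Set.Ioi (0 : ℝ), (ENNReal.ofReal t ^ γ *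
        ((∫⁻ s in Set.Ioo 0 t, φ s) / ENNReal.ofReal t)) ^ Q / ENNReal.ofReal t ≤
      K ^ (Q - 1) * ∫⁻ s in Set.Ioi (0 : ℝ),
        {z : ℝ × ℝ | z.1 < z.2}.indicator
          (fun z => ψ z.1 * ENNReal.ofReal z.2 ^ (γ - 2)) (s, t) := by
    intro t ht
    have hτ : ENNReal.ofReal t ≠ 0 := by simpa using ht
    have hτ' : ENNReal.ofReal t ≠ ⊤ := ENNReal.ofReal_ne_top
    have hin : ∫⁻ s in Set.Ioi (0 : ℝ), {z : ℝ × ℝ | z.1 < z.2}.indicator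
          (fun z => ψ z.1 * ENNReal.ofReal z.2 ^ (γ - 2)) (s, t) =
        (∫⁻ s in Set.Ioo 0 t, ψ s) * ENNReal.ofReal t ^ (γ - 2) := by
      rw [← lintegral_mul_const _ hψm, ← lintegral_indicator measurableSet_Ioi,
        ← lintegral_indicator measurableSet_Ioo]
      refine lintegral_congr fun s => ?_
      by_cases h0 : 0 < s <;> by_cases h1 : s < t <;> simp [Set.indicator, h0, h1]
    rw [hin]
    calc (ENNReal.ofReal t ^ γ * ((∫⁻ s in Set.Ioo 0 t, φ s) / ENNReal.ofReal t)) ^ Q /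
          ENNReal.ofReal t
        = (∫⁻ s in Set.Ioo 0 t, φ s) ^ Q * ENNReal.ofReal t ^ (γ * Q - Q - 1) := by
          rw [div_eq_mul_inv, div_eq_mul_inv, ← ENNReal.rpow_neg_one, mul_left_comm,
            ← ENNReal.rpow_add _ _ hτ hτ', ENNReal.mul_rpow_of_nonneg _ _ hQ0, ← ENNReal.rpow_mul,
            mul_assoc, ← ENNReal.rpow_add _ _ hτ hτ']
          ring_nf
      _ ≤ ((∫⁻ s in Set.Ioo 0 t, ψ s) * (K * ENNReal.ofReal t ^ (1 - γ)) ^ (Q - 1)) *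
            ENNReal.ofReal t ^ (γ * Q - Q - 1) := by
          gcongr
          exact setLIntegral_rpow_le hγ hQ ht hφ
      _ = _ := by
          rw [ENNReal.mul_rpow_of_nonneg _ _ (by linarith), ← ENNReal.rpow_mul]
          have : ENNReal.ofReal t ^ (γ - 2) = ENNReal.ofReal t ^ ((1 - γ) * (Q - 1)) *
              ENNReal.ofReal t ^ (γ * Q - Q - 1) := by
            rw [← ENNReal.rpow_add _ _ hτ hτ']; ring_nf
          rw [this]
          ring
  have hmeas : Measurable ({z : ℝ × ℝ | z.1 < z.2}.indicator
      (fun z : ℝ × ℝ => ψ z.1 * ENNReal.ofReal z.2 ^ (γ - 2))) :=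
    ((hψm.comp measurable_fst).mul ((hm _).comp measurable_snd)).indicator
      (measurableSet_lt measurable_fst measurable_snd)
  calc _ ≤ ∫⁻ t in Set.Ioi (0 : ℝ), K ^ (Q - 1) * ∫⁻ s in Set.Ioi (0 : ℝ),
        {z : ℝ × ℝ | z.1 < z.2}.indicator
          (fun z => ψ z.1 * ENNReal.ofReal z.2 ^ (γ - 2)) (s, t) :=
        setLIntegral_mono' measurableSet_Ioi hpt
    _ = K ^ (Q - 1) * ∫⁻ s in Set.Ioi (0 : ℝ), ∫⁻ t in Set.Ioi (0 : ℝ),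
        {z : ℝ × ℝ | z.1 < z.2}.indicator
          (fun z => ψ z.1 * ENNReal.ofReal z.2 ^ (γ - 2)) (s, t) := by
        rw [lintegral_const_mul']
        · congr 1
          exact (lintegral_lintegral_swap (f := fun s t => {z : ℝ × ℝ | z.1 < z.2}.indicator
            (fun z => ψ z.1 * ENNReal.ofReal z.2 ^ (γ - 2)) (s, t)) hmeas.aemeasurable).symm
        · exact ENNReal.rpow_ne_top_of_nonneg (by linarith) ENNReal.ofReal_ne_top
    _ = K ^ (Q - 1) * ∫⁻ s in Set.Ioi (0 : ℝ),
          K * ((ENNReal.ofReal s ^ γ * φ s) ^ Q / ENNReal.ofReal s) := by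
        congr 1
        refine setLIntegral_congr_fun measurableSet_Ioi fun s (hs : 0 < s) => ?_
        have hσ : ENNReal.ofReal s ≠ 0 := by simpa using hs
        have hσ' : ENNReal.ofReal s ≠ ⊤ := ENNReal.ofReal_ne_top
        have hin : ∫⁻ t in Set.Ioi (0 : ℝ), {z : ℝ × ℝ | z.1 < z.2}.indicator
              (fun z => ψ z.1 * ENNReal.ofReal z.2 ^ (γ - 2)) (s, t) =
            ψ s * ∫⁻ t in Set.Ioi s, ENNReal.ofReal t ^ (γ - 2) := by
          rw [← lintegral_const_mul _ (hm _), ← lintegral_indicator measurableSet_Ioi,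
            ← lintegral_indicator measurableSet_Ioi]
          refine lintegral_congr fun t => ?_
          by_cases h1 : s < t
          · simp [Set.indicator, h1, hs.trans h1]
          · simp [Set.indicator, h1]
        rw [hin, setLIntegral_Ioi_rpow hγ hs, hψ]
        simp only
        rw [ENNReal.mul_rpow_of_nonneg _ _ hQ0, div_eq_mul_inv, ← ENNReal.rpow_neg_one,
          ← ENNReal.rpow_mul]
        have e1 : ENNReal.ofReal s ^ (γ * (Q - 1)) * ENNReal.ofReal s ^ (γ - 1) =
            ENNReal.ofReal s ^ (γ * Q) * ENNReal.ofReal s ^ (-1 : ℝ) := by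
          rw [← ENNReal.rpow_add _ _ hσ hσ', ← ENNReal.rpow_add _ _ hσ hσ']; ring_nf
        calc _ = K * φ s ^ Q *
              (ENNReal.ofReal s ^ (γ * (Q - 1)) * ENNReal.ofReal s ^ (γ - 1)) := by ring
          _ = _ := by rw [e1]; ring
    _ = _ := by
        rw [lintegral_const_mul' _ _ ENNReal.ofReal_ne_top, ← mul_assoc]
        congr 1
        have hK0 : K ≠ 0 := by
          simpa [hK] using hγ
        have h := ENNReal.rpow_add (Q - 1) 1 hK0 ENNReal.ofReal_ne_top
        rw [ENNReal.rpow_one, sub_add_cancel] at h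
        exact h.symm

/-- The endpoint `q = ∞` of Hardy's inequality. -/
theorem rpow_mul_mean_le {γ t : ℝ} (hγ : γ < 1) (ht : 0 < t) {φ : ℝ → ℝ≥0∞} {S : ℝ≥0∞}
    (hS : ∀ s, 0 < s → ENNReal.ofReal s ^ γ * φ s ≤ S) :
    ENNReal.ofReal t ^ γ * ((∫⁻ s in Set.Ioo 0 t, φ s) / ENNReal.ofReal t) ≤
      ENNReal.ofReal (1 - γ)⁻¹ * S := by
  have hτ : ENNReal.ofReal t ≠ 0 := by simpa using ht
  have hτ' : ENNReal.ofReal t ≠ ⊤ := ENNReal.ofReal_ne_top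
  have h1 : ∫⁻ s in Set.Ioo 0 t, φ s ≤
      S * (ENNReal.ofReal (1 - γ)⁻¹ * ENNReal.ofReal t ^ (1 - γ)) := by
    rw [← setLIntegral_Ioo_rpow_neg hγ ht,
      ← lintegral_const_mul _ (ENNReal.measurable_ofReal.pow_const _)]
    refine setLIntegral_mono' measurableSet_Ioo fun s hs => ?_
    have hσ : ENNReal.ofReal s ≠ 0 := by simpa using hs.1
    calc φ s = ENNReal.ofReal s ^ γ * φ s * ENNReal.ofReal s ^ (-γ) := by
          rw [mul_right_comm, ← ENNReal.rpow_add _ _ hσ ENNReal.ofReal_ne_top]; simp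
      _ ≤ _ := by gcongr; exact hS s hs.1
  calc _ ≤ ENNReal.ofReal t ^ γ *
        (S * (ENNReal.ofReal (1 - γ)⁻¹ * ENNReal.ofReal t ^ (1 - γ)) / ENNReal.ofReal t) := by
        gcongr
    _ = ENNReal.ofReal (1 - γ)⁻¹ * S * (ENNReal.ofReal t ^ γ * ENNReal.ofReal t ^ (1 - γ) *
          ENNReal.ofReal t ^ (-1 : ℝ)) := by
        rw [div_eq_mul_inv, ← ENNReal.rpow_neg_one]; ring
    _ = _ := by
        rw [← ENNReal.rpow_add _ _ hτ hτ', ← ENNReal.rpow_add _ _ hτ hτ']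
        simp

/-! ### Lorentz norms -/

section LorentzNorm

variable {α F F' : Type*} [MeasureSpace α] [NormedAddCommGroup F] [NormedAddCommGroup F']
  {Ω : Set α} {f : α → F} {h : α → F'} {p q : ℝ≥0∞}

theorem toReal_inv_lt_one (hp : 1 < p) : (p⁻¹).toReal < 1 := by
  have h1 : p⁻¹ < 1 := ENNReal.inv_lt_one.2 hp
  simpa using (ENNReal.toReal_lt_toReal (h1.trans ENNReal.one_lt_top).ne ENNReal.one_ne_top).2 h1

/-- Hardy's inequality in terms of Lorentz norms: if `h^*` is dominated by `M` times the mean of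
`f^*` over `(0, t)`, then the norm of `h` is at most `M (1 - 1 / p)⁻¹` times that of `f`. -/
theorem lorentzNorm_le_of_decreasingRearrangement_le_mean (hp : 1 < p) (hq : 1 ≤ q)
    {M : ℝ≥0∞} (hM : M ≠ ⊤)
    (hle : ∀ t, 0 < t → decreasingRearrangement Ω h t ≤
      M * ((∫⁻ s in Set.Ioo 0 t, decreasingRearrangement Ω f s) / ENNReal.ofReal t)) :
    lorentzNorm p q Ω h ≤ M * ENNReal.ofReal (1 - (p⁻¹).toReal)⁻¹ * lorentzNorm p q Ω f := by
  have hγ := toReal_inv_lt_one hp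
  set γ := (p⁻¹).toReal
  unfold lorentzNorm
  split_ifs with hqt
  · refine iSup₂_le fun t ht => ?_
    set S := ⨆ t ∈ Set.Ioi (0 : ℝ), ENNReal.ofReal t ^ γ * decreasingRearrangement Ω f t
    calc ENNReal.ofReal t ^ γ * decreasingRearrangement Ω h t
        ≤ ENNReal.ofReal t ^ γ *
          (M * ((∫⁻ s in Set.Ioo 0 t, decreasingRearrangement Ω f s) / ENNReal.ofReal t)) := by
          gcongr; exact hle t ht
      _ = M * (ENNReal.ofReal t ^ γ *
          ((∫⁻ s in Set.Ioo 0 t, decreasingRearrangement Ω f s) / ENNReal.ofReal t)) := by ring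
      _ ≤ M * (ENNReal.ofReal (1 - γ)⁻¹ * S) := by
          gcongr M * ?_
          exact rpow_mul_mean_le hγ ht fun s hs =>
            le_iSup₂_of_le (f := fun t (_ : t ∈ Set.Ioi (0 : ℝ)) =>
              ENNReal.ofReal t ^ γ * decreasingRearrangement Ω f t) s hs le_rfl
      _ = _ := by ring
  · have hQ : 1 ≤ q.toReal := by
      simpa using (ENNReal.toReal_le_toReal ENNReal.one_ne_top hqt).2 hq
    have hQ0 : 0 < q.toReal := by linarith
    have hinv : (q⁻¹).toReal = q.toReal⁻¹ := ENNReal.toReal_inv q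
    rw [hinv]
    set Q := q.toReal
    set K := ENNReal.ofReal (1 - γ)⁻¹
    calc _ ≤ (∫⁻ t in Set.Ioi (0 : ℝ), M ^ Q * ((ENNReal.ofReal t ^ γ *
          ((∫⁻ s in Set.Ioo 0 t, decreasingRearrangement Ω f s) / ENNReal.ofReal t)) ^ Q /
            ENNReal.ofReal t)) ^ Q⁻¹ := by
          gcongr ?_ ^ Q⁻¹
          refine setLIntegral_mono' measurableSet_Ioi fun t ht => ?_
          rw [← mul_div_assoc, ← ENNReal.mul_rpow_of_nonneg _ _ hQ0.le]
          gcongr ?_ ^ Q / _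
          rw [mul_left_comm]
          gcongr
          exact hle t ht
      _ ≤ (M ^ Q * (K ^ Q * ∫⁻ t in Set.Ioi (0 : ℝ), (ENNReal.ofReal t ^ γ *
            decreasingRearrangement Ω f t) ^ Q / ENNReal.ofReal t)) ^ Q⁻¹ := by
          rw [lintegral_const_mul' _ _ (ENNReal.rpow_ne_top_of_nonneg hQ0.le hM)]
          gcongr
          exact lintegral_mean_rpow_le hγ hQ measurable_decreasingRearrangement
      _ = _ := by
          rw [← mul_assoc, ← ENNReal.mul_rpow_of_nonneg _ _ hQ0.le,
            ENNReal.mul_rpow_of_nonneg _ _ (inv_nonneg.2 hQ0.le), ENNReal.rpow_rpow_inv hQ0.ne']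

/-- A function in `L^{p,q}` of a set of finite measure, `p > 1`, is integrable: by Hardy's
inequality the means of its rearrangement over `(0, t)` are finite for almost every `t`. -/
theorem setLIntegral_enorm_lt_top_of_lorentzNorm [SFinite (volume : Measure α)]
    [MeasurableSpace F] [OpensMeasurableSpace F] (hf : Measurable f) (hΩ : volume Ω ≠ ⊤)
    (hp : 1 < p) (hq : 1 ≤ q) (hfin : lorentzNorm p q Ω f < ⊤) :
    ∫⁻ x in Ω, ‖f x‖ₑ < ⊤ := by
  have hγ := toReal_inv_lt_one hp
  set γ := (p⁻¹).toReal
  set T := (volume Ω).toReal + 1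
  have hT0 : 0 < T := by positivity
  suffices hs : ∃ t, T ≤ t ∧ ENNReal.ofReal t ^ γ *
      ((∫⁻ s in Set.Ioo 0 t, decreasingRearrangement Ω f s) / ENNReal.ofReal t) < ⊤ by
    obtain ⟨t, hTt, ht⟩ := hs
    have hτ : ENNReal.ofReal t ≠ 0 := by simpa using hT0.trans_le hTt
    have hΩt : volume Ω ≤ ENNReal.ofReal t := by
      rw [← ENNReal.ofReal_toReal hΩ]
      exact ENNReal.ofReal_le_ofReal (by linarith)
    refine (setLIntegral_enorm_le hf hΩt).trans_lt ?_
    by_contra htop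
    rw [not_lt, top_le_iff] at htop
    have h0 : ENNReal.ofReal t ^ γ ≠ 0 := by
      simp [ENNReal.rpow_eq_zero_iff, hτ]
    rw [htop, ENNReal.top_div_of_ne_top ENNReal.ofReal_ne_top, ENNReal.mul_top h0] at ht
    exact lt_irrefl _ ht
  unfold lorentzNorm at hfin
  split_ifs at hfin with hqt
  · refine ⟨T, le_rfl, (rpow_mul_mean_le hγ hT0 fun s hs => ?_).trans_lt
      (ENNReal.mul_lt_top ENNReal.ofReal_lt_top hfin)⟩
    exact le_iSup₂_of_le (f := fun t (_ : t ∈ Set.Ioi (0 : ℝ)) =>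
              ENNReal.ofReal t ^ γ * decreasingRearrangement Ω f t) s hs le_rfl
  · have hQ : 1 ≤ q.toReal := by
      simpa using (ENNReal.toReal_le_toReal ENNReal.one_ne_top hqt).2 hq
    have hQ0 : 0 < q.toReal := by linarith
    rw [ENNReal.toReal_inv q] at hfin
    have hfin' := (ENNReal.rpow_lt_top_iff_of_pos (inv_pos.2 hQ0)).1 hfin
    set Q := q.toReal
    have hH := (lintegral_mean_rpow_le hγ hQ
      (measurable_decreasingRearrangement (Ω := Ω) (f := f))).trans_lt (ENNReal.mul_lt_top
        (ENNReal.rpow_lt_top_of_nonneg hQ0.le ENNReal.ofReal_ne_top) hfin')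
    by_contra! hcon
    have hle := lintegral_mono_set (μ := volume) (f := fun t => (ENNReal.ofReal t ^ γ *
      ((∫⁻ s in Set.Ioo 0 t, decreasingRearrangement Ω f s) / ENNReal.ofReal t)) ^ Q /
        ENNReal.ofReal t) (Set.Ioi_subset_Ioi hT0.le)
    have hval : ∫⁻ t in Set.Ioi T, (ENNReal.ofReal t ^ γ *
      ((∫⁻ s in Set.Ioo 0 t, decreasingRearrangement Ω f s) / ENNReal.ofReal t)) ^ Q /
        ENNReal.ofReal t = ∫⁻ t in Set.Ioi T, (⊤ : ℝ≥0∞) := by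
      refine setLIntegral_congr_fun measurableSet_Ioi fun t ht => ?_
      have := top_le_iff.1 (hcon t (le_of_lt ht))
      rw [this, ENNReal.top_rpow_of_pos hQ0, ENNReal.top_div_of_ne_top ENNReal.ofReal_ne_top]
    rw [hval] at hle
    simp at hle
    exact hH.ne hle

theorem distributionFunction_congr_ae (hΩ : MeasurableSet Ω) {f' : α → F}
    (hff' : f =ᵐ[volume.restrict Ω] f') :
    distributionFunction Ω f = distributionFunction Ω f' := by
  ext a
  refine measure_congr ?_
  filter_upwards [(ae_restrict_iff' hΩ).1 hff'] with x hx
  refine propext ⟨fun hx' => ⟨hx'.1, ?_⟩, fun hx' => ⟨hx'.1, ?_⟩⟩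
  · rw [← hx hx'.1]; exact hx'.2
  · rw [hx hx'.1]; exact hx'.2

theorem lorentzNorm_congr_ae (hΩ : MeasurableSet Ω) {f' : α → F}
    (hff' : f =ᵐ[volume.restrict Ω] f') : lorentzNorm p q Ω f = lorentzNorm p q Ω f' := by
  have : decreasingRearrangement Ω f = decreasingRearrangement Ω f' := by
    ext t
    rw [decreasingRearrangement, decreasingRearrangement, distributionFunction_congr_ae hΩ hff']
  rw [lorentzNorm, lorentzNorm, this]

end LorentzNorm

/-! ### Averages along segments -/

section Segment

variable {E : Type*} [NormedAddCommGroup E] [NormedSpace ℝ E] [MeasureSpace E]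

/-- The integral of `u` over the segments that join `x` to the points of `B`. -/
noncomputable def segmentIntegral (B : Set E) (u : E → ℝ≥0∞) (x : E) : ℝ≥0∞ :=
  ∫⁻ y in B, ∫⁻ s in Set.Ioo (0 : ℝ) 1, u ((1 - s) • x + s • y)

/-- The `L^∞` bound for `segmentIntegral`, applied to the part of `u` below the level `c`. -/
theorem segmentIntegral_le_const_add (B : Set E) (u : E → ℝ≥0∞) (c : ℝ≥0∞)
    (x : E) : segmentIntegral B u x ≤ volume B * c + segmentIntegral B (fun z => u z - c) x := by
  calc segmentIntegral B u x ≤ ∫⁻ y in B, (c + ∫⁻ s in Set.Ioo (0 : ℝ) 1,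
        (u ((1 - s) • x + s • y) - c)) := by
        refine lintegral_mono fun y => ?_
        calc _ ≤ ∫⁻ s in Set.Ioo (0 : ℝ) 1, (c + (u ((1 - s) • x + s • y) - c)) :=
              lintegral_mono fun s => le_add_tsub
          _ = _ := by rw [lintegral_add_left measurable_const]; simp
    _ = _ := by
        rw [lintegral_add_left measurable_const, setLIntegral_const, mul_comm]
        rfl

variable [FiniteDimensional ℝ E] [BorelSpace E]

theorem measurable_comp_convexCombination {u : E → ℝ≥0∞} (hu : Measurable u) :
    Measurable fun z : (E × E) × ℝ => u ((1 - z.2) • z.1.1 + z.2 • z.1.2) :=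
  hu.comp (by fun_prop)

variable [(volume : Measure E).IsAddHaarMeasure]

theorem lintegral_comp_smul_add {r : ℝ} (hr : 0 < r) (b : E) {u : E → ℝ≥0∞} (hu : Measurable u) :
    ∫⁻ x, u (r • x + b) = ENNReal.ofReal (r⁻¹ ^ Module.finrank ℝ E) * ∫⁻ x, u x := by
  have h1 : ∫⁻ x, u (r • x + b) = ∫⁻ x, u (x + b) ∂(Measure.map (r • ·) volume) := by
    exact (lintegral_map (f := fun x => u (x + b)) (hu.comp (measurable_add_const b))
      (measurable_const_smul r)).symm
  rw [h1, Measure.map_addHaar_smul volume hr.ne', lintegral_smul_measure,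
    lintegral_add_right_eq_self u b, smul_eq_mul, abs_of_pos (by positivity), inv_pow]

/-- For weights `r + s = 1` one of them is at least `1 / 2`; change variables in that one. -/
theorem setLIntegral_setLIntegral_convexCombination_le {B : Set E} {s : ℝ}
    {u : E → ℝ≥0∞} (hu : Measurable u) :
    ∫⁻ x in B, ∫⁻ y in B, u ((1 - s) • x + s • y) ≤
      2 ^ Module.finrank ℝ E * volume B * ∫⁻ x, u x := by
  have key : ∀ r : ℝ, 1 / 2 ≤ r → ∀ b : E,
      ∫⁻ x in B, u (r • x + b) ≤ 2 ^ Module.finrank ℝ E * ∫⁻ x, u x := by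
    intro r hr b
    have hr0 : 0 < r := by linarith
    calc ∫⁻ x in B, u (r • x + b) ≤ ∫⁻ x, u (r • x + b) := setLIntegral_le_lintegral _ _
      _ = ENNReal.ofReal (r⁻¹ ^ Module.finrank ℝ E) * ∫⁻ x, u x := lintegral_comp_smul_add hr0 b hu
      _ ≤ _ := by
        gcongr
        rw [← ENNReal.ofReal_ofNat 2, ← ENNReal.ofReal_pow (by norm_num)]
        refine ENNReal.ofReal_le_ofReal (pow_le_pow_left₀ (by positivity) ?_ _)
        rw [inv_le_comm₀ hr0 (by norm_num)]
        linarith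
  have hm : Measurable fun z : E × E => u ((1 - s) • z.1 + s • z.2) := hu.comp (by fun_prop)
  rcases le_total s (1 / 2) with h | h
  · rw [lintegral_lintegral_swap hm.aemeasurable]
    calc _ ≤ ∫⁻ y in B, 2 ^ Module.finrank ℝ E * ∫⁻ x, u x :=
          lintegral_mono fun y => key (1 - s) (by linarith) (s • y)
      _ = _ := by rw [setLIntegral_const]; ring
  · calc _ ≤ ∫⁻ x in B, 2 ^ Module.finrank ℝ E * ∫⁻ x, u x :=
          lintegral_mono fun x => by simpa only [add_comm] using key s h ((1 - s) • x)
      _ = _ := by rw [setLIntegral_const]; ring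

theorem measurable_segmentIntegral (B : Set E) {u : E → ℝ≥0∞} (hu : Measurable u) :
    Measurable (segmentIntegral B u) := by
  have h1 : Measurable fun z : E × E =>
      ∫⁻ s in Set.Ioo (0 : ℝ) 1, u ((1 - s) • z.1 + s • z.2) :=
    (measurable_comp_convexCombination hu).lintegral_prod_right'
  exact h1.lintegral_prod_right'

/-- The `L¹` bound for `segmentIntegral`. -/
theorem setLIntegral_segmentIntegral_le (B : Set E) {u : E → ℝ≥0∞} (hu : Measurable u) :
    ∫⁻ x in B, segmentIntegral B u x ≤ 2 ^ Module.finrank ℝ E * volume B * ∫⁻ x, u x := by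
  have h1 : ∫⁻ x in B, segmentIntegral B u x =
      ∫⁻ s in Set.Ioo (0 : ℝ) 1, ∫⁻ x in B, ∫⁻ y in B, u ((1 - s) • x + s • y) := by
    have h2 : ∀ x, segmentIntegral B u x =
        ∫⁻ s in Set.Ioo (0 : ℝ) 1, ∫⁻ y in B, u ((1 - s) • x + s • y) := fun x =>
      lintegral_lintegral_swap (f := fun y s => u ((1 - s) • x + s • y))
        (hu.comp (by fun_prop)).aemeasurable
    simp_rw [h2]
    refine lintegral_lintegral_swap
      (f := fun x s => ∫⁻ y in B, u ((1 - s) • x + s • y)) (Measurable.aemeasurable ?_)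
    exact Measurable.lintegral_prod_right' (f := fun z : (E × ℝ) × E =>
      u ((1 - z.1.2) • z.1.1 + z.1.2 • z.2)) (hu.comp (by fun_prop))
  rw [h1]
  calc _ ≤ ∫⁻ s in Set.Ioo (0 : ℝ) 1, 2 ^ Module.finrank ℝ E * volume B * ∫⁻ x, u x :=
        lintegral_mono fun s => setLIntegral_setLIntegral_convexCombination_le hu
    _ = _ := by simp

end Segment

/-! ### Weak gradients and differences -/

section WeakGradient

variable {E : Type*} [NormedAddCommGroup E] [InnerProductSpace ℝ E] [FiniteDimensional ℝ E]
  [MeasureSpace E] [BorelSpace E] [(volume : Measure E).IsAddHaarMeasure]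

theorem integrable_prod_inner_comp_add_smul {G : E → E} (hGm : Measurable G) (hG : Integrable G)
    (v : E) :
    Integrable (fun z : E × ℝ => inner ℝ (G (z.1 + z.2 • v)) v)
      (volume.prod (volume.restrict (Set.Ioo (0 : ℝ) 1))) := by
  have hm : Measurable fun z : E × ℝ => G (z.1 + z.2 • v) := hGm.comp (by fun_prop)
  have h1 : Integrable (fun z : E × ℝ => G (z.1 + z.2 • v))
      (volume.prod (volume.restrict (Set.Ioo (0 : ℝ) 1))) := by
    rw [integrable_prod_iff' hm.aestronglyMeasurable]
    refine ⟨ae_of_all _ fun s => hG.comp_add_right (s • v), ?_⟩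
    have : ∀ s : ℝ, ∫ x, ‖G (x + s • v)‖ = ∫ x, ‖G x‖ := fun s =>
      integral_add_right_eq_self (fun x => ‖G x‖) (s • v)
    simp_rw [this]
    exact integrable_const _
  exact h1.inner_const v

/-- The weak form of the fundamental theorem of calculus along segments of direction `v`. It
follows by testing the definition of the weak gradient with the translates `ψ (· - s v)` of a test
function and integrating over `s ∈ (0, 1)`. -/
theorem ae_sub_eq_integral_inner {B : Set E} (hBo : IsOpen B) (hBc : Convex ℝ B) {F : E → ℝ}
    {G : E → E} (hF : LocallyIntegrableOn F B) (hGm : Measurable G) (hG : Integrable G)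
    (hweak : ∀ ψ : E → ℝ, ContDiff ℝ (⊤ : ℕ∞) ψ → HasCompactSupport ψ → tsupport ψ ⊆ B →
      ∀ v, ∫ x, F x * fderiv ℝ ψ x v = -∫ x, inner ℝ (G x) v * ψ x) (v : E) :
    ∀ᵐ x, x ∈ B → x + v ∈ B →
      F (x + v) - F x = ∫ s in Set.Ioo (0 : ℝ) 1, inner ℝ (G (x + s • v)) v := by
  set U : Set E := B ∩ (fun x => x + v) ⁻¹' B
  have hUo : IsOpen U := hBo.inter (hBo.preimage (by fun_prop))
  have hFK : ∀ K ⊆ B, IsCompact K → IntegrableOn F K := fun K hK hKc =>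
    hF.integrableOn_compact_subset hK hKc
  have hGint := integrable_prod_inner_comp_add_smul hGm hG v
  have hGprod : Integrable (fun x => ∫ s in Set.Ioo (0 : ℝ) 1, inner ℝ (G (x + s • v)) v) :=
    hGint.integral_prod_left
  set D : E → ℝ := fun x =>
    F (x + v) - F x - ∫ s in Set.Ioo (0 : ℝ) 1, inner ℝ (G (x + s • v)) v with hD
  have hDloc : LocallyIntegrableOn D U := by
    rw [locallyIntegrableOn_iff hUo.isLocallyClosed]
    intro K hK hKc
    have h1 : IntegrableOn F K := hFK K (hK.trans Set.inter_subset_left) hKc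
    have h2 : IntegrableOn F ((fun x => x + v) '' K) := by
      refine hFK _ ?_ (hKc.image (by fun_prop))
      rintro _ ⟨x, hx, rfl⟩
      exact (hK hx).2
    have h3 : IntegrableOn (fun x => F (x + v)) K := by
      have := ((measurePreserving_add_right volume v).integrableOn_comp_preimage
        (measurableEmbedding_addRight v)).2 h2
      rwa [Set.preimage_image_eq _ (add_left_injective v)] at this
    exact (h3.sub h1).sub hGprod.integrableOn
  have hzero : ∀ᵐ x, x ∈ U → D x = 0 := by
    refine hUo.ae_eq_zero_of_integral_contDiff_smul_eq_zero hDloc fun ψ hψ hψc hψU => ?_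
    have hψcont : Continuous ψ := hψ.continuous
    have hψd : Differentiable ℝ ψ := hψ.differentiable (by simp)
    have hψ' : Continuous fun x => fderiv ℝ ψ x v :=
      (hψ.continuous_fderiv (by simp)).clm_apply continuous_const
    -- `K` contains the supports of all translates `ψ (· - s v)`, `s ∈ [0, 1]`.
    set K : Set E := (fun z : E × ℝ => z.1 + z.2 • v) '' (tsupport ψ ×ˢ Set.Icc (0 : ℝ) 1)
    have hKc : IsCompact K := (hψc.isCompact.prod isCompact_Icc).image (by fun_prop)
    have hKB : K ⊆ B := by
      rintro _ ⟨⟨z, s⟩, ⟨hz, hs⟩, rfl⟩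
      have hzU := hψU hz
      have := hBc hzU.1 hzU.2 (sub_nonneg.2 hs.2) hs.1 (by ring)
      have e : (1 - s) • z + s • (z + v) = z + s • v := by
        rw [smul_add, sub_smul, one_smul]; abel
      simpa only [e] using this
    have hmemK : ∀ x : E, ∀ s ∈ Set.Icc (0 : ℝ) 1, x - s • v ∈ tsupport ψ → x ∈ K :=
      fun x s hs hx => ⟨(x - s • v, s), ⟨hx, hs⟩, by simp⟩
    set FK : E → ℝ := K.indicator F with hFKdef
    have hFKint : Integrable FK := (hFK K hKB hKc).integrable_indicator hKc.measurableSet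
    have hFψ : ∀ x : E, ∀ s ∈ Set.Icc (0 : ℝ) 1, F x * ψ (x - s • v) = FK x * ψ (x - s • v) := by
      intro x s hs
      by_cases hx : x ∈ K
      · rw [hFKdef, Set.indicator_of_mem hx]
      · have : ψ (x - s • v) = 0 := by
          by_contra h
          exact hx (hmemK x s hs (subset_tsupport _ h))
        rw [this, mul_zero, mul_zero]
    have hFψ' : ∀ x : E, ∀ s ∈ Set.Icc (0 : ℝ) 1,
        F x * fderiv ℝ ψ (x - s • v) v = FK x * fderiv ℝ ψ (x - s • v) v := by
      intro x s hs
      by_cases hx : x ∈ K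
      · rw [hFKdef, Set.indicator_of_mem hx]
      · have : fderiv ℝ ψ (x - s • v) = 0 := by
          by_contra h
          exact hx (hmemK x s hs (support_fderiv_subset ℝ h))
        simp [this]
    obtain ⟨C, hC⟩ := hψc.exists_bound_of_continuous hψcont
    obtain ⟨C', hC'⟩ := (hψc.fderiv_apply ℝ v).exists_bound_of_continuous hψ'
    -- The translates are admissible test functions.
    have htest : ∀ s ∈ Set.Icc (0 : ℝ) 1, ∫ x, FK x * fderiv ℝ ψ (x - s • v) v =
        -∫ x, inner ℝ (G x) v * ψ (x - s • v) := by
      intro s hs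
      have h1 := hweak (fun x => ψ (x - s • v)) (hψ.comp (by fun_prop))
        (hψc.comp_homeomorph (Homeomorph.subRight (s • v)))
        (fun x hx => hKB (hmemK x s hs
          (tsupport_comp_subset_preimage ψ (f := fun x => x - s • v) (by fun_prop) hx))) v
      rw [← h1]
      refine integral_congr_ae (ae_of_all _ fun x => ?_)
      simp only
      rw [← hFψ' x s hs, fderiv_comp_sub]
    have hftc : ∀ x, ψ (x - v) - ψ x = -∫ s in Set.Ioo (0 : ℝ) 1, fderiv ℝ ψ (x - s • v) v := by
      intro x
      have hder : ∀ s ∈ Set.uIcc (0 : ℝ) 1,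
          HasDerivAt (fun s : ℝ => ψ (x - s • v)) (-(fderiv ℝ ψ (x - s • v) v)) s := by
        intro s _
        have h1 : HasDerivAt (fun s : ℝ => x - s • v) (-v) s := by
          simpa using ((hasDerivAt_id s).smul_const v).const_sub x
        simpa [Function.comp_def] using (hψd (x - s • v)).hasFDerivAt.comp_hasDerivAt s h1
      have hcont : Continuous fun s : ℝ => -(fderiv ℝ ψ (x - s • v) v) :=
        (hψ'.comp (by fun_prop)).neg
      have := intervalIntegral.integral_eq_sub_of_hasDerivAt hder (hcont.intervalIntegrable 0 1)
      rw [intervalIntegral.integral_of_le zero_le_one, integral_Ioc_eq_integral_Ioo,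
        integral_neg] at this
      simpa using this.symm
    have hint1 : Integrable (fun z : E × ℝ => FK z.1 * fderiv ℝ ψ (z.1 - z.2 • v) v)
        (volume.prod (volume.restrict (Set.Ioo (0 : ℝ) 1))) := by
      refine (hFKint.comp_fst _).mul_bdd (c := C') ?_ (ae_of_all _ fun z => hC' _)
      exact (hψ'.comp (by fun_prop)).aestronglyMeasurable
    have hint2 : Integrable (fun z : E × ℝ => inner ℝ (G (z.1 + z.2 • v)) v * ψ z.1)
        (volume.prod (volume.restrict (Set.Ioo (0 : ℝ) 1))) :=
      hGint.mul_bdd (c := C) (hψcont.comp continuous_fst).aestronglyMeasurable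
        (ae_of_all _ fun z => hC _)
    have hFKψ : ∀ s : ℝ, Integrable fun x => FK x * ψ (x - s • v) := fun s =>
      hFKint.mul_bdd (c := C) (hψcont.comp (by fun_prop)).aestronglyMeasurable
        (ae_of_all _ fun z => hC _)
    have hi1 : Integrable fun x => ψ x * F (x + v) := by
      have h1 := (hFKψ 1).comp_add_right v
      refine h1.congr (ae_of_all _ fun x => ?_)
      simp only
      rw [← hFψ _ 1 ⟨zero_le_one, le_rfl⟩]
      simp [mul_comm]
    have hi0 : Integrable fun x => ψ x * F x := by
      refine (hFKψ 0).congr (ae_of_all _ fun x => ?_)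
      simp only
      rw [← hFψ _ 0 ⟨le_rfl, zero_le_one⟩]
      simp [mul_comm]
    have hi2 : Integrable fun x =>
        ψ x * ∫ s in Set.Ioo (0 : ℝ) 1, inner ℝ (G (x + s • v)) v := by
      refine hint2.integral_prod_left.congr (ae_of_all _ fun x => ?_)
      simp only
      rw [integral_mul_const, mul_comm]
    have e1 : ∫ x, ψ x * F (x + v) = ∫ x, FK x * ψ (x - v) := by
      rw [← integral_add_right_eq_self (fun x => FK x * ψ (x - v)) v]
      refine integral_congr_ae (ae_of_all _ fun x => ?_)
      have := hFψ (x + v) 1 ⟨zero_le_one, le_rfl⟩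
      simp only [one_smul] at this
      simp only
      rw [← this, add_sub_cancel_right, mul_comm]
    have e0 : ∫ x, ψ x * F x = ∫ x, FK x * ψ x := by
      refine integral_congr_ae (ae_of_all _ fun x => ?_)
      have := hFψ x 0 ⟨le_rfl, zero_le_one⟩
      simp only [zero_smul, sub_zero] at this
      simp only
      rw [← this, mul_comm]
    have hmain : ∫ x, ψ x * F (x + v) - ψ x * F x =
        ∫ x, ψ x * ∫ s in Set.Ioo (0 : ℝ) 1, inner ℝ (G (x + s • v)) v := by
      rw [integral_sub hi1 hi0, e1, e0, ← integral_sub (by simpa using hFKψ 1)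
        (by simpa using hFKψ 0)]
      calc ∫ x, FK x * ψ (x - v) - FK x * ψ x
          = ∫ x, -∫ s in Set.Ioo (0 : ℝ) 1, FK x * fderiv ℝ ψ (x - s • v) v := by
            refine integral_congr_ae (ae_of_all _ fun x => ?_)
            simp only
            rw [← mul_sub, hftc, mul_neg, integral_const_mul]
        _ = -∫ s in Set.Ioo (0 : ℝ) 1, ∫ x, FK x * fderiv ℝ ψ (x - s • v) v := by
            rw [integral_neg]
            congr 1
            exact integral_integral_swap hint1
        _ = ∫ s in Set.Ioo (0 : ℝ) 1, ∫ x, inner ℝ (G (x + s • v)) v * ψ x := by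
            rw [← integral_neg]
            refine setIntegral_congr_fun measurableSet_Ioo fun s hs => ?_
            rw [htest s ⟨hs.1.le, hs.2.le⟩, neg_neg,
              ← integral_add_right_eq_self (fun x => inner ℝ (G x) v * ψ (x - s • v)) (s • v)]
            simp
        _ = ∫ x, ∫ s in Set.Ioo (0 : ℝ) 1, inner ℝ (G (x + s • v)) v * ψ x :=
            (integral_integral_swap hint2).symm
        _ = _ := by
            refine integral_congr_ae (ae_of_all _ fun x => ?_)
            simp only
            rw [integral_mul_const, mul_comm]
    calc ∫ x, ψ x • D x = ∫ x, (ψ x * F (x + v) - ψ x * F x) -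
          ψ x * ∫ s in Set.Ioo (0 : ℝ) 1, inner ℝ (G (x + s • v)) v := by
          refine integral_congr_ae (ae_of_all _ fun x => ?_)
          simp only [hD, smul_eq_mul]
          ring
      _ = 0 := by
          rw [integral_sub (f := fun x => ψ x * F (x + v) - ψ x * F x) (hi1.sub hi0) hi2, hmain,
            sub_self]
  filter_upwards [hzero] with x hx hxB hxv
  exact sub_eq_zero.1 (hx ⟨hxB, hxv⟩)

end WeakGradient

theorem integrable_mul_of_tsupport_subset {E : Type*} [TopologicalSpace E] [T2Space E]
    [MeasurableSpace E] [OpensMeasurableSpace E] {μ : Measure E} {B : Set E} {f φ : E → ℝ}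
    (hf : LocallyIntegrableOn f B μ) (hφ : Continuous φ) (hφc : HasCompactSupport φ)
    (hφB : tsupport φ ⊆ B) : Integrable (fun x => f x * φ x) μ := by
  have h1 : IntegrableOn (fun x => f x * φ x) (tsupport φ) μ :=
    (hf.integrableOn_compact_subset hφB hφc.isCompact).mul_continuousOn hφ.continuousOn
      hφc.isCompact
  refine (integrableOn_iff_integrable_of_support_subset fun x hx => ?_).1 h1
  exact subset_tsupport _ (right_ne_zero_of_mul hx)

/-- The coordinatewise definition of the weak gradient gives the identity in every direction. -/
theorem IsWeakGradient.setIntegral_mul_fderiv {n : ℕ} {Ω : Set (EuclideanSpace ℝ (Fin n))}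
    {f : EuclideanSpace ℝ (Fin n) → ℝ} {g : EuclideanSpace ℝ (Fin n) → EuclideanSpace ℝ (Fin n)}
    (h : IsWeakGradient Ω f g) {ψ : EuclideanSpace ℝ (Fin n) → ℝ} (hψ : ContDiff ℝ (⊤ : ℕ∞) ψ)
    (hψc : HasCompactSupport ψ) (hψΩ : tsupport ψ ⊆ Ω) (v : EuclideanSpace ℝ (Fin n)) :
    ∫ x in Ω, f x * fderiv ℝ ψ x v = -∫ x in Ω, inner ℝ (g x) v * ψ x := by
  have hg : ∀ i, LocallyIntegrableOn (fun x => g x i) Ω := fun i x hx => by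
    obtain ⟨s, hs, hi⟩ := h.locallyIntegrableOn_grad x hx
    exact ⟨s, hs, (EuclideanSpace.proj (𝕜 := ℝ) i).integrable_comp hi⟩
  have hint1 : ∀ i : Fin n, IntegrableOn
      (fun x => v i * (f x * fderiv ℝ ψ x (EuclideanSpace.single i 1))) Ω := fun i =>
    ((integrable_mul_of_tsupport_subset h.locallyIntegrableOn
      ((hψ.continuous_fderiv (by simp)).clm_apply continuous_const) (hψc.fderiv_apply ℝ _)
      ((tsupport_fderiv_apply_subset ℝ _).trans hψΩ)).const_mul (v i)).integrableOn
  have hint2 : ∀ i : Fin n, IntegrableOn (fun x => v i * (g x i * ψ x)) Ω := fun i =>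
    ((integrable_mul_of_tsupport_subset (hg i) hψ.continuous hψc hψΩ).const_mul (v i)).integrableOn
  have hv : ∑ i, v i • EuclideanSpace.single i (1 : ℝ) = v := by
    simpa using (EuclideanSpace.basisFun (Fin n) ℝ).sum_repr v
  calc ∫ x in Ω, f x * fderiv ℝ ψ x v
      = ∫ x in Ω, ∑ i, v i * (f x * fderiv ℝ ψ x (EuclideanSpace.single i 1)) := by
        congr 1
        ext x
        conv_lhs => rw [← hv]
        rw [map_sum, Finset.mul_sum]
        refine Finset.sum_congr rfl fun i _ => ?_
        rw [map_smul, smul_eq_mul]; ring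
    _ = ∑ i, v i * -∫ x in Ω, g x i * ψ x := by
        rw [integral_finsetSum _ fun i _ => hint1 i]
        refine Finset.sum_congr rfl fun i _ => ?_
        rw [integral_const_mul, h.integral_eq ψ hψ hψc hψΩ i]
    _ = -∫ x in Ω, ∑ i, v i * (g x i * ψ x) := by
        rw [integral_finsetSum _ fun i _ => hint2 i, ← Finset.sum_neg_distrib]
        refine Finset.sum_congr rfl fun i _ => ?_
        rw [integral_const_mul, mul_neg]
    _ = _ := by
        congr 2
        ext x
        rw [PiLp.inner_apply, Finset.sum_mul]
        refine Finset.sum_congr rfl fun i _ => ?_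
        simp [mul_assoc]

/-- For almost every pair of points, the difference of the values of `F` is at most the integral of
`|G|` over the segment between them. The differences in a fixed direction `v` are treated one `v` at
a time, and Fubini's theorem turns "for every `v`, almost every `x`" into "for almost every `x`,
almost every `y = x + v`". -/
theorem ae_ae_enorm_sub_le {E : Type*} [NormedAddCommGroup E] [InnerProductSpace ℝ E]
    [FiniteDimensional ℝ E] [MeasureSpace E] [BorelSpace E]
    [(volume : Measure E).IsAddHaarMeasure] {B : Set E} (hBo : IsOpen B) (hBc : Convex ℝ B)
    {F : E → ℝ} {G : E → E} (hFm : Measurable F) (hF : LocallyIntegrableOn F B)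
    (hGm : Measurable G) (hG : Integrable G)
    (hweak : ∀ ψ : E → ℝ, ContDiff ℝ (⊤ : ℕ∞) ψ → HasCompactSupport ψ → tsupport ψ ⊆ B →
      ∀ v, ∫ x, F x * fderiv ℝ ψ x v = -∫ x, inner ℝ (G x) v * ψ x) :
    ∀ᵐ x, x ∈ B → ∀ᵐ y, y ∈ B → ‖F x - F y‖ₑ ≤
      ‖y - x‖ₑ * ∫⁻ s in Set.Ioo (0 : ℝ) 1, ‖G ((1 - s) • x + s • y)‖ₑ := by
  have h1 : ∀ v : E, ∀ᵐ x, x ∈ B → x + v ∈ B → ‖F (x + v) - F x‖ₑ ≤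
      ‖v‖ₑ * ∫⁻ s in Set.Ioo (0 : ℝ) 1, ‖G (x + s • v)‖ₑ := by
    intro v
    filter_upwards [ae_sub_eq_integral_inner hBo hBc hF hGm hG hweak v] with x hx hxB hxv
    rw [hx hxB hxv]
    refine (enorm_integral_le_lintegral_enorm _).trans ?_
    have hm : Measurable fun s : ℝ => ‖G (x + s • v)‖ₑ := (hGm.comp (by fun_prop)).enorm
    rw [← lintegral_const_mul _ hm]
    refine lintegral_mono fun s => ?_
    rw [mul_comm]
    simp only [← ofReal_norm]
    rw [← ENNReal.ofReal_mul (norm_nonneg _)]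
    exact ENNReal.ofReal_le_ofReal (norm_inner_le_norm _ _)
  have hmeas : MeasurableSet {z : E × E | z.2 ∈ B → z.2 + z.1 ∈ B → ‖F (z.2 + z.1) - F z.2‖ₑ ≤
      ‖z.1‖ₑ * ∫⁻ s in Set.Ioo (0 : ℝ) 1, ‖G (z.2 + s • z.1)‖ₑ} := by
    refine MeasurableSet.imp (hBo.measurableSet.preimage measurable_snd) (MeasurableSet.imp
      (hBo.measurableSet.preimage (measurable_snd.add measurable_fst)) (measurableSet_le ?_ ?_))
    · exact ((hFm.comp (measurable_snd.add measurable_fst)).sub (hFm.comp measurable_snd)).enorm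
    · refine measurable_fst.enorm.mul ?_
      exact Measurable.lintegral_prod_right' (f := fun z : (E × E) × ℝ =>
        ‖G (z.1.2 + z.2 • z.1.1)‖ₑ) (hGm.comp (by fun_prop)).enorm
  have h2 := (Measure.ae_ae_comm (μ := (volume : Measure E)) (ν := (volume : Measure E))
    hmeas).1 (ae_of_all _ h1)
  filter_upwards [h2] with x hx hxB
  filter_upwards [(measurePreserving_sub_right volume x).quasiMeasurePreserving.ae hx] with y hy hyB
  have h3 := hy hxB (by simpa using hyB)
  have e : ∀ s : ℝ, x + s • (y - x) = (1 - s) • x + s • y := fun s => by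
    rw [smul_sub, sub_smul, one_smul]; abel
  simp only [e, add_sub_cancel] at h3
  rwa [← neg_sub, enorm_neg]

/-! ### The Poincaré inequality -/

theorem enorm_sub_setAverage_le {E : Type*} [MeasureSpace E]
    {B : Set E} (hB0 : volume B ≠ 0) (hB : volume B ≠ ⊤)
    {F : E → ℝ} (hF : IntegrableOn F B) (x : E) :
    ‖F x - ⨍ y in B, F y‖ₑ ≤ (volume B)⁻¹ * ∫⁻ y in B, ‖F x - F y‖ₑ := by
  have hr : volume.real B ≠ 0 := (ENNReal.toReal_pos hB0 hB).ne'
  have e : F x - ⨍ y in B, F y = (volume.real B)⁻¹ * ∫ y in B, (F x - F y) := by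
    have hc : IntegrableOn (fun _ : E => F x) B := integrableOn_const hB
    rw [integral_sub hc hF, setAverage_eq, setIntegral_const, smul_eq_mul,
      smul_eq_mul]
    field_simp
  rw [e, enorm_mul]
  gcongr
  · rw [enorm_inv hr, Measure.real, ← ofReal_norm, Real.norm_of_nonneg (by positivity),
      ENNReal.ofReal_toReal hB]
  · exact enorm_integral_le_lintegral_enorm _

section Poincare

variable {E : Type*} [NormedAddCommGroup E] [InnerProductSpace ℝ E] [FiniteDimensional ℝ E]
  [MeasureSpace E] [BorelSpace E]

theorem ae_setLIntegral_enorm_sub_le {x₀ : E} {ρ : ℝ} {F : E → ℝ} {G : E → E} (hGm : Measurable G)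
    (hdiff : ∀ᵐ x, x ∈ Metric.ball x₀ ρ → ∀ᵐ y, y ∈ Metric.ball x₀ ρ → ‖F x - F y‖ₑ ≤
      ‖y - x‖ₑ * ∫⁻ s in Set.Ioo (0 : ℝ) 1, ‖G ((1 - s) • x + s • y)‖ₑ) :
    ∀ᵐ x, x ∈ Metric.ball x₀ ρ → ∫⁻ y in Metric.ball x₀ ρ, ‖F x - F y‖ₑ ≤
      ENNReal.ofReal (2 * ρ) * segmentIntegral (Metric.ball x₀ ρ) (fun z => ‖G z‖ₑ) x := by
  filter_upwards [hdiff] with x hx hxB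
  have hm : Measurable fun y => ∫⁻ s in Set.Ioo (0 : ℝ) 1, ‖G ((1 - s) • x + s • y)‖ₑ :=
    Measurable.lintegral_prod_right' (f := fun z : E × ℝ => ‖G ((1 - z.2) • x + z.2 • z.1)‖ₑ)
      (hGm.comp (by fun_prop)).enorm
  rw [segmentIntegral, ← lintegral_const_mul _ hm]
  refine lintegral_mono_ae ((ae_restrict_iff' measurableSet_ball).2 ?_)
  filter_upwards [hx hxB] with y hy hyB
  refine (hy hyB).trans ?_
  gcongr
  rw [← ofReal_norm, ← dist_eq_norm]
  refine ENNReal.ofReal_le_ofReal ?_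
  have h1 := Metric.mem_ball.1 hxB
  have h2 := Metric.mem_ball.1 hyB
  have := dist_triangle_right y x x₀
  linarith

variable [(volume : Measure E).IsAddHaarMeasure]

/-- Integrability up to the boundary of the ball: the segment integral of `|G|` is finite at some
`x`, and there `F x - F` is integrable. -/
theorem integrableOn_ball_of_enorm_sub_le {x₀ : E} {ρ : ℝ} (hρ : 0 < ρ) {F : E → ℝ} {G : E → E}
    (hFm : Measurable F) (hGm : Measurable G) (hG : Integrable G)
    (hle : ∀ᵐ x, x ∈ Metric.ball x₀ ρ → ∫⁻ y in Metric.ball x₀ ρ, ‖F x - F y‖ₑ ≤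
      ENNReal.ofReal (2 * ρ) * segmentIntegral (Metric.ball x₀ ρ) (fun z => ‖G z‖ₑ) x) :
    IntegrableOn F (Metric.ball x₀ ρ) := by
  set B := Metric.ball x₀ ρ
  have hBfin : volume B ≠ ⊤ := measure_ball_lt_top.ne
  have hfin : ∫⁻ x in B, segmentIntegral B (fun z => ‖G z‖ₑ) x ≠ ⊤ := by
    refine ((setLIntegral_segmentIntegral_le B hGm.enorm).trans_lt ?_).ne
    exact ENNReal.mul_lt_top (ENNReal.mul_lt_top (by simp) hBfin.lt_top) hG.hasFiniteIntegral
  have h1 := ae_lt_top (measurable_segmentIntegral B hGm.enorm) hfin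
  rw [ae_restrict_iff' measurableSet_ball] at h1
  have hpos : volume B ≠ 0 := (Metric.measure_ball_pos volume x₀ hρ).ne'
  obtain ⟨x, hxB, hx1, hx2⟩ : ∃ x ∈ B, segmentIntegral B (fun z => ‖G z‖ₑ) x < ⊤ ∧
      ∫⁻ y in B, ‖F x - F y‖ₑ ≤
        ENNReal.ofReal (2 * ρ) * segmentIntegral B (fun z => ‖G z‖ₑ) x := by
    by_contra! hcon
    refine hpos (measure_mono_null (t := {x | ¬ (x ∉ B)}) (fun x hx => not_not.2 hx) ?_)
    have : ∀ᵐ x, x ∉ B := by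
      filter_upwards [h1, hle] with x hx hx' hxB
      exact absurd (hx' hxB) (not_le.2 (hcon x hxB (hx hxB)))
    exact this
  have h2 : IntegrableOn (fun y => F x - F y) B :=
    ⟨(measurable_const.sub hFm).aestronglyMeasurable,
      hx2.trans_lt (ENNReal.mul_lt_top ENNReal.ofReal_lt_top hx1)⟩
  have h3 : IntegrableOn (fun _ : E => F x) B := integrableOn_const hBfin
  have := h3.sub h2
  refine this.congr (ae_of_all _ fun y => ?_)
  simp

/-- The Poincaré inequality for everywhere defined measurable functions. -/
theorem lorentzNorm_sub_setAverage_le {p q : ℝ≥0∞} (hp : 1 < p) (hq : 1 ≤ q) {x₀ : E} {ρ : ℝ}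
    (hρ : 0 < ρ) {F : E → ℝ} {G : E → E}
    (hFm : Measurable F) (hF : LocallyIntegrableOn F (Metric.ball x₀ ρ))
    (hGm : Measurable G) (hG0 : ∀ x ∉ Metric.ball x₀ ρ, G x = 0)
    (hfin : lorentzNorm p q (Metric.ball x₀ ρ) G < ⊤)
    (hweak : ∀ ψ : E → ℝ, ContDiff ℝ (⊤ : ℕ∞) ψ → HasCompactSupport ψ →
      tsupport ψ ⊆ Metric.ball x₀ ρ →
      ∀ v, ∫ x, F x * fderiv ℝ ψ x v = -∫ x, inner ℝ (G x) v * ψ x) :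
    IntegrableOn F (Metric.ball x₀ ρ) ∧
      lorentzNorm p q (Metric.ball x₀ ρ) (fun x => F x - ⨍ y in Metric.ball x₀ ρ, F y) ≤
        ENNReal.ofReal (2 * ρ) * 2 ^ Module.finrank ℝ E *
          ENNReal.ofReal (1 - (p⁻¹).toReal)⁻¹ * lorentzNorm p q (Metric.ball x₀ ρ) G := by
  have hlocal : ∀ u : E → ℝ≥0∞, (∀ x ∉ Metric.ball x₀ ρ, u x = 0) →
      ∫⁻ x, u x = ∫⁻ x in Metric.ball x₀ ρ, u x := by
    intro u hu
    rw [← lintegral_indicator measurableSet_ball]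
    refine lintegral_congr fun x => ?_
    by_cases hx : x ∈ Metric.ball x₀ ρ
    · rw [Set.indicator_of_mem hx]
    · rw [Set.indicator_of_notMem hx, hu x hx]
  have hBfin : volume (Metric.ball x₀ ρ) ≠ ⊤ := measure_ball_lt_top.ne
  have hpos : volume (Metric.ball x₀ ρ) ≠ 0 := (Metric.measure_ball_pos volume x₀ hρ).ne'
  have hG : Integrable G := by
    refine ⟨hGm.aestronglyMeasurable, ?_⟩
    rw [HasFiniteIntegral, hlocal _ fun x hx => by simp [hG0 x hx]]
    exact setLIntegral_enorm_lt_top_of_lorentzNorm hGm hBfin hp hq hfin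
  have hle := ae_setLIntegral_enorm_sub_le hGm
    (ae_ae_enorm_sub_le Metric.isOpen_ball (convex_ball x₀ ρ) hFm hF hGm hG hweak)
  have hFint := integrableOn_ball_of_enorm_sub_le hρ hFm hGm hG hle
  refine ⟨hFint, ?_⟩
  set B := Metric.ball x₀ ρ
  set A : ℝ≥0∞ := (volume B)⁻¹ * ENNReal.ofReal (2 * ρ) with hA
  have hAB : A * volume B = ENNReal.ofReal (2 * ρ) := by
    rw [hA, mul_right_comm, ENNReal.inv_mul_cancel hpos hBfin, one_mul]
  refine lorentzNorm_le_of_decreasingRearrangement_le_mean hp hq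
    (ENNReal.mul_ne_top ENNReal.ofReal_ne_top (by simp)) fun t ht => ?_
  refine decreasingRearrangement_le_mean hGm
    (fun c x => A * segmentIntegral B (fun z => ‖G z‖ₑ - c) x)
    (fun c => (measurable_segmentIntegral B (hGm.enorm.sub_const c)).const_mul A)
    (fun c => ?_) (fun c => ?_) ht
  · filter_upwards [hle] with x hx hxB
    calc ‖F x - ⨍ y in B, F y‖ₑ ≤ (volume B)⁻¹ * ∫⁻ y in B, ‖F x - F y‖ₑ :=
          enorm_sub_setAverage_le hpos hBfin hFint x
      _ ≤ (volume B)⁻¹ * (ENNReal.ofReal (2 * ρ) * segmentIntegral B (fun z => ‖G z‖ₑ) x) := by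
          gcongr; exact hx hxB
      _ ≤ A * (volume B * c + segmentIntegral B (fun z => ‖G z‖ₑ - c) x) := by
          rw [← mul_assoc]
          gcongr
          exact segmentIntegral_le_const_add B _ c x
      _ = ENNReal.ofReal (2 * ρ) * 1 * c + A * segmentIntegral B (fun z => ‖G z‖ₑ - c) x := by
          rw [mul_add, ← mul_assoc, hAB, mul_one]
      _ ≤ _ := by
          gcongr
          exact one_le_pow₀ one_le_two
  · rw [lintegral_const_mul _ (measurable_segmentIntegral B (hGm.enorm.sub_const c))]
    calc _ ≤ A * (2 ^ Module.finrank ℝ E * volume B * ∫⁻ x, (‖G x‖ₑ - c)) := by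
          gcongr; exact setLIntegral_segmentIntegral_le B (hGm.enorm.sub_const c)
      _ = A * volume B * 2 ^ Module.finrank ℝ E * ∫⁻ x, (‖G x‖ₑ - c) := by ring
      _ = _ := by rw [hAB, hlocal _ fun x hx => by simp [hG0 x hx]]

end Poincare

/-- Poincaré inequality in Lorentz spaces on balls: if `f ∈ L¹_loc` has a weak gradient `g` in
`L^{p,q}` of the ball, then `f` is integrable on the ball (so that its mean is defined), and
`‖f - mean f‖_{p,q} ≤ C ρ ‖g‖_{p,q}` with `C` depending only on `n`, `p`, `q`. -/
theorem lemma2p2 (n : ℕ) (hn : 2 < n) (p q : ℝ≥0∞) (hp : 1 < p) (hp' : p < ⊤) (hq : 1 ≤ q) :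
    ∃ C : ℝ, 0 < C ∧
      ∀ (x₀ : EuclideanSpace ℝ (Fin n)) (ρ : ℝ), 0 < ρ →
      ∀ (f : EuclideanSpace ℝ (Fin n) → ℝ)
        (g : EuclideanSpace ℝ (Fin n) → EuclideanSpace ℝ (Fin n)),
        IsWeakGradient (Metric.ball x₀ ρ) f g →
        lorentzNorm p q (Metric.ball x₀ ρ) g < ⊤ →
        IntegrableOn f (Metric.ball x₀ ρ) ∧
        lorentzNorm p q (Metric.ball x₀ ρ) (fun x => f x - ⨍ y in Metric.ball x₀ ρ, f y) ≤
          ENNReal.ofReal (C * ρ) * lorentzNorm p q (Metric.ball x₀ ρ) g := by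
  have hγ : 0 < (1 - (p⁻¹).toReal)⁻¹ := inv_pos.2 (sub_pos.2 (toReal_inv_lt_one hp))
  refine ⟨2 * 2 ^ n * (1 - (p⁻¹).toReal)⁻¹, by positivity, ?_⟩
  intro x₀ ρ hρ f g hfg hfin
  set B := Metric.ball x₀ ρ
  have hBm : MeasurableSet B := measurableSet_ball
  have hfm := hfg.locallyIntegrableOn.aestronglyMeasurable
  have hgm := hfg.locallyIntegrableOn_grad.aestronglyMeasurable
  -- Measurable representatives; that of the gradient is extended by zero.
  set F := hfm.mk f
  set G := B.indicator (hgm.mk g)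
  have hfF : f =ᵐ[volume.restrict B] F := hfm.ae_eq_mk
  have hgG : g =ᵐ[volume.restrict B] G := by
    filter_upwards [hgm.ae_eq_mk, ae_restrict_mem hBm] with x hx hxB
    rw [hx]
    exact (Set.indicator_of_mem hxB _).symm
  have hFm : Measurable F := hfm.stronglyMeasurable_mk.measurable
  have hGm : Measurable G := hgm.stronglyMeasurable_mk.measurable.indicator hBm
  have hG0 : ∀ x ∉ B, G x = 0 := fun x hx => Set.indicator_of_notMem hx _
  have hF : LocallyIntegrableOn F B := by
    rw [locallyIntegrableOn_iff Metric.isOpen_ball.isLocallyClosed]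
    intro K hKB hK
    exact (hfg.locallyIntegrableOn.integrableOn_compact_subset hKB hK).congr
      (ae_restrict_of_ae_restrict_of_subset hKB hfF)
  have hweak : ∀ ψ : EuclideanSpace ℝ (Fin n) → ℝ, ContDiff ℝ (⊤ : ℕ∞) ψ → HasCompactSupport ψ →
      tsupport ψ ⊆ B → ∀ v, ∫ x, F x * fderiv ℝ ψ x v = -∫ x, inner ℝ (G x) v * ψ x := by
    intro ψ hψ hψc hψB v
    have h1 : ∫ x, F x * fderiv ℝ ψ x v = ∫ x in B, F x * fderiv ℝ ψ x v := by
      refine (setIntegral_eq_integral_of_forall_compl_eq_zero fun x hx => ?_).symm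
      have : fderiv ℝ ψ x = 0 := by
        by_contra h
        exact hx (hψB (support_fderiv_subset ℝ h))
      simp [this]
    have h2 : ∫ x, inner ℝ (G x) v * ψ x = ∫ x in B, inner ℝ (G x) v * ψ x := by
      refine (setIntegral_eq_integral_of_forall_compl_eq_zero fun x hx => ?_).symm
      simp [hG0 x hx]
    have h3 : ∫ x in B, F x * fderiv ℝ ψ x v = ∫ x in B, f x * fderiv ℝ ψ x v :=
      integral_congr_ae (by filter_upwards [hfF] with x hx; rw [hx])
    have h4 : ∫ x in B, inner ℝ (G x) v * ψ x = ∫ x in B, inner ℝ (g x) v * ψ x :=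
      integral_congr_ae (by filter_upwards [hgG] with x hx; rw [hx])
    rw [h1, h2, h3, h4, hfg.setIntegral_mul_fderiv hψ hψc hψB v]
  rw [lorentzNorm_congr_ae hBm hgG] at hfin ⊢
  obtain ⟨hint, hle⟩ := lorentzNorm_sub_setAverage_le hp hq hρ hFm hF hGm hG0 hfin hweak
  refine ⟨hint.congr hfF.symm, ?_⟩
  have havg : ⨍ y in B, f y = ⨍ y in B, F y := by
    rw [setAverage_eq, setAverage_eq, integral_congr_ae hfF]
  have hsub : (fun x => f x - ⨍ y in B, f y) =ᵐ[volume.restrict B]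
      fun x => F x - ⨍ y in B, F y := by
    filter_upwards [hfF] with x hx
    rw [hx, havg]
  rw [lorentzNorm_congr_ae hBm hsub]
  refine hle.trans_eq ?_
  congr 1
  rw [finrank_euclideanSpace_fin, show 2 * 2 ^ n * (1 - (p⁻¹).toReal)⁻¹ * ρ =
    2 * ρ * 2 ^ n * (1 - (p⁻¹).toReal)⁻¹ by ring,
    ENNReal.ofReal_mul (p := 2 * ρ * 2 ^ n) (by positivity),
    ENNReal.ofReal_mul (p := 2 * ρ) (by positivity), ENNReal.ofReal_pow (by norm_num),
    ENNReal.ofReal_ofNat]
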